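/- An $((n,M,d;c))$ entanglement-assisted (EA) quantum code is an $M$-dimensional subspace $\mathcal Q$ ($M\ge 1$) of the $(n+c)$-qubit state space $(\mathbb C^2)^{\otimes n}\otimes(\mathbb C^2)^{\otimes c}$ (Alice's $n$ qubits and Bob's $c$ qubits) such that: 1) every unit vector $|\psi\rangle\in\mathcal Q$ satisfies $\mathrm{Tr}_A(|\psi\rangle\langle\psi|)=2^{-c}\,\mathbb I^B$; 2) for every $n$-fold tensor product $E$ of the Pauli matrices $I,X,Y,Z$ with at most $d-1$ nonidentity factors, the operator $E\otimes\mathbb I^B$ is detectable, i.e. $P(E\otimes\mathbb I^B)P=\lambda_E P$ for some $\lambda_E\in\mathbb C$, where $P$ is the orthogonal projector onto $\mathcal Q$. Let $H_2(x)=-x\log_2 x-(1-x)\log_2(1-x)$, with $H_2(0)=0$. Then there is a sequence $(\varepsilon_n)$ of real numbers with $\varepsilon_n\to 0$ as $n\to\infty$ such that every $((n,M,d;c))$ EA quantum code (degenerate or not, additive or not) with $n\ge1$ and relative distance $\delta=d/n<1/3$ satisfies $$\frac{\log_2 M}{n}\le 1+\rho-\frac{\delta}{2}\log_2 3-H_2\!\left(\frac{\delta}{2}\right)+\varepsilon_n,\qquad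 \rho=\frac cn.$$ -/

import Mathlib

open Filter Topology
open scoped Kronecker

namespace EAQuantum

/-- Labels of the four single-qubit Pauli matrices. -/
inductive Pauli where
  | I
  | X
  | Y
  | Z
  deriving DecidableEq

/-- The single-qubit Pauli matrices; `Y = i X Z`. -/
noncomputable def Pauli.toMatrix : Pauli → Matrix (Fin 2) (Fin 2) ℂ
  | .I => 1
  | .X => !![0, 1; 1, 0]
  | .Y => Complex.I • (!![0, 1; 1, 0] * !![1, 0; 0, -1])
  | .Z => !![1, 0; 0, -1]

/-- The computational basis labels (bit strings) of `n` qubits. -/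
abbrev Bits (n : ℕ) : Type := Fin n → Fin 2

/-- The state space `ℂ ^ (2 ^ (n + c)) = (ℂ²)^{⊗ n} ⊗ (ℂ²)^{⊗ c}` of Alice's `n` qubits together
with Bob's `c` qubits, with its Hermitian inner product; the basis vector `(a, b)` is
`|a⟩ ⊗ |b⟩`. -/
abbrev StateSpace (n c : ℕ) : Type := EuclideanSpace ℂ (Bits n × Bits c)

/-- The Pauli operator `M₁ ⊗ ⋯ ⊗ Mₙ`, as a matrix in the computational basis: the entries of a
tensor product are the products of the entries of the factors. -/
noncomputable def pauliString {n : ℕ} (g : Fin n → Pauli) : Matrix (Bits n) (Bits n) ℂ :=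
  Matrix.of fun a b => ∏ j, (g j).toMatrix (a j) (b j)

/-- The weight of a Pauli operator: its number of nonidentity factors. -/
def weight {n : ℕ} (g : Fin n → Pauli) : ℕ :=
  (Finset.univ.filter fun j => g j ≠ Pauli.I).card

/-- The partial trace over Alice's qubits. -/
noncomputable def partialTraceA {n c : ℕ}
    (A : Matrix (Bits n × Bits c) (Bits n × Bits c) ℂ) : Matrix (Bits c) (Bits c) ℂ :=
  Matrix.of fun b b' => ∑ a, A (a, b) (a, b')

/-- The matrix `|ψ⟩⟨ψ|`. -/
noncomputable def ketBra {n c : ℕ} (ψ : StateSpace n c) :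
    Matrix (Bits n × Bits c) (Bits n × Bits c) ℂ :=
  Matrix.of fun x y => ψ x * star (ψ y)

/-- The error operator with matrix `E` is detectable by the code `Q`: `P E P = lam P` for some
scalar `lam`, where `P` is the orthogonal projector onto `Q`. -/
def Detectable {n c : ℕ} (Q : Submodule ℂ (StateSpace n c))
    (E : Matrix (Bits n × Bits c) (Bits n × Bits c) ℂ) : Prop :=
  ∃ lam : ℂ,
    Q.starProjection ∘L Matrix.toEuclideanCLM (𝕜 := ℂ) E ∘L Q.starProjection =
      lam • Q.starProjection

/-- `Q` is an `((n, M, d; c))` entanglement-assisted quantum code. The codewords in `reduced`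
are states, that is, unit vectors. -/
structure IsEACode (n M d c : ℕ) (Q : Submodule ℂ (StateSpace n c)) : Prop where
  finrank_eq : Module.finrank ℂ Q = M
  reduced : ∀ ψ ∈ Q, ‖ψ‖ = 1 →
    partialTraceA (ketBra ψ) = ((1 : ℂ) / 2 ^ c) • (1 : Matrix (Bits c) (Bits c) ℂ)
  detectable : ∀ g : Fin n → Pauli, weight g < d →
    Detectable Q (pauliString g ⊗ₖ (1 : Matrix (Bits c) (Bits c) ℂ))

/-- The binary entropy function, with logarithms to base 2. -/
noncomputable def binaryEntropy (x : ℝ) : ℝ :=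
  -x * Real.logb 2 x - (1 - x) * Real.logb 2 (1 - x)

end EAQuantum

/-! ### Pauli strings, partial trace and the matrix of the code projector -/

namespace EAQuantum

open Matrix Finset

/-! The proof is a Delsarte-type linear programming argument. For the code projector `P` and Pauli
strings `E_g` on Alice's side, let `A g = |tr (E_g P)|²`, `B g = tr (E_g P E_g P)` and `C g = ‖Tr_A
(E_g P)‖²` (Hilbert–Schmidt norm). Detectability gives `M * B g = A g` below weight `d`, a
MacWilliams identity makes `2 ^ n * C` the character transform of `B`, and Cauchy–Schwarz on Bob's
space gives `A ≤ 2 ^ c * C`. Pairing these with a test function `φ` yields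
`IsEACode.linear_programming`.

The test function is `φ g = K_e(weight g)²` with `K_e` the quaternary Krawtchouk polynomial and `e =
(d - 1) / 2`. Its transform is `4 ^ n` times the number of pairs of strings of weight `e` whose
product is `g` up to phase, so it vanishes beyond weight `2 * e`. What remains is
`transform_le_krawtchouk_sq`: for `6 * e ≤ n` the transform is at most `4 ^ n * (n + 1) / K_e(0)`
times `φ`. The pair count is bounded above by a Chernoff-type generating function (`transform_le`),
and `K_e` below by ratios of consecutive values, propagated through the three-term recurrence
(`krawtchouk_pos_and_ratio`). Both estimates reduce to piecewise linear inequalities in `weight g /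
e`.

The outcome is the Hamming bound `IsEACode.hamming`, with only a factor `n + 1` lost; entropy
estimates for the binomial coefficient finish the proof. -/

instance : Fintype Pauli := ⟨{.I, .X, .Y, .Z}, fun p => by cases p <;> decide⟩

theorem Pauli.univ_eq : (univ : Finset Pauli) = {.I, .X, .Y, .Z} := rfl

theorem Pauli.sum_univ {R : Type*} [AddCommMonoid R] (f : Pauli → R) :
    ∑ p, f p = f .I + (f .X + (f .Y + f .Z)) := by
  rw [Pauli.univ_eq, sum_insert (by decide), sum_insert (by decide), sum_insert (by decide),
    sum_singleton]

/-- The commutation sign of two Pauli matrices. -/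
def Pauli.sign (p q : Pauli) : ℝ := if p = .I ∨ q = .I ∨ p = q then 1 else -1

/-- The commutation sign of two Pauli strings. -/
def stringSign {n : ℕ} (g h : Fin n → Pauli) : ℝ := ∏ j, (g j).sign (h j)

theorem Pauli.toMatrix_conjTranspose (p : Pauli) : p.toMatrixᴴ = p.toMatrix := by
  cases p <;> ext i j <;> fin_cases i <;> fin_cases j <;> simp [Pauli.toMatrix]

theorem Pauli.toMatrix_mul_mul (p q : Pauli) :
    q.toMatrix * p.toMatrix * q.toMatrix = ((p.sign q : ℝ) : ℂ) • p.toMatrix := by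
  cases p <;> cases q <;> ext i j <;> fin_cases i <;> fin_cases j <;>
    simp [Pauli.toMatrix, Pauli.sign]

/-- Completeness of the Pauli basis; its tensor power is what makes the average over conjugations a
partial trace. -/
theorem Pauli.sum_mul_toMatrix (a a' e e' : Fin 2) :
    ∑ p : Pauli, p.toMatrix a a' * p.toMatrix e' e = if a = e ∧ a' = e' then 2 else 0 := by
  rw [Pauli.sum_univ]
  fin_cases a <;> fin_cases a' <;> fin_cases e <;> fin_cases e' <;>
    simp [Pauli.toMatrix] <;> norm_num

theorem pauliString_conjTranspose {n : ℕ} (g : Fin n → Pauli) :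
    (pauliString g)ᴴ = pauliString g := by
  ext a b
  simp only [conjTranspose_apply, pauliString, of_apply, star_prod]
  refine prod_congr rfl fun j _ => ?_
  rw [← conjTranspose_apply, Pauli.toMatrix_conjTranspose]

theorem pauliString_mul_mul {n : ℕ} (g h : Fin n → Pauli) :
    pauliString h * pauliString g * pauliString h =
      ((stringSign g h : ℝ) : ℂ) • pauliString g := by
  have key : ∀ A B : Fin n → Matrix (Fin 2) (Fin 2) ℂ,
      (Matrix.of fun a b : Bits n => ∏ j, A j (a j) (b j)) *
        (Matrix.of fun a b : Bits n => ∏ j, B j (a j) (b j)) =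
      Matrix.of fun a b : Bits n => ∏ j, (A j * B j) (a j) (b j) := by
    intro A B
    ext a b
    simp only [mul_apply, of_apply, ← prod_mul_distrib]
    rw [Fintype.prod_sum]
  unfold pauliString
  rw [key, key]
  ext a b
  simp only [of_apply, Matrix.smul_apply, Pauli.toMatrix_mul_mul, smul_eq_mul, prod_mul_distrib,
    stringSign, Complex.ofReal_prod]

theorem sum_mul_pauliString {n : ℕ} (a a' e e' : Bits n) :
    ∑ g : Fin n → Pauli, pauliString g a a' * pauliString g e' e =
      if a = e ∧ a' = e' then 2 ^ n else 0 := by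
  simp only [pauliString, of_apply, ← prod_mul_distrib]
  rw [← Fintype.prod_sum fun j p => Pauli.toMatrix p (a j) (a' j) * Pauli.toMatrix p (e' j) (e j)]
  simp only [Pauli.sum_mul_toMatrix]
  split_ifs with h
  · obtain ⟨rfl, rfl⟩ := h
    simp
  · rw [not_and_or] at h
    rcases h with h | h
    · obtain ⟨j, hj⟩ := Function.ne_iff.1 h
      exact prod_eq_zero (mem_univ j) (by simp [hj])
    · obtain ⟨j, hj⟩ := Function.ne_iff.1 h
      exact prod_eq_zero (mem_univ j) (by simp [hj])

/-- A Pauli string on Alice's qubits, acting trivially on Bob's. -/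
noncomputable def aliceString {n : ℕ} (c : ℕ) (g : Fin n → Pauli) :
    Matrix (Bits n × Bits c) (Bits n × Bits c) ℂ := pauliString g ⊗ₖ 1

variable {n c : ℕ}

theorem aliceString_conjTranspose (g : Fin n → Pauli) :
    (aliceString c g)ᴴ = aliceString c g := by
  rw [aliceString, conjTranspose_kronecker, pauliString_conjTranspose, conjTranspose_one]

theorem aliceString_mul_mul (g h : Fin n → Pauli) :
    aliceString c h * aliceString c g * aliceString c h =
      ((stringSign g h : ℝ) : ℂ) • aliceString c g := by
  simp only [aliceString, ← mul_kronecker_mul, pauliString_mul_mul, mul_one, smul_kronecker]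

/-- Averaging over all Pauli conjugations on Alice's side erases her system. -/
theorem sum_aliceString_mul_mul (Y : Matrix (Bits n × Bits c) (Bits n × Bits c) ℂ) :
    ∑ g : Fin n → Pauli, aliceString c g * Y * aliceString c g =
      (2 : ℂ) ^ n • ((1 : Matrix (Bits n) (Bits n) ℂ) ⊗ₖ partialTraceA Y) := by
  ext ⟨a, b⟩ ⟨e, f⟩
  have h1 : ∀ g : Fin n → Pauli, (aliceString c g * Y * aliceString c g) (a, b) (e, f) =
      ∑ e' : Bits n, ∑ a' : Bits n, (pauliString g a a' * pauliString g e' e) * Y (a', b) (e', f) := by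
    intro g
    simp only [mul_apply, aliceString, kroneckerMap_apply, Fintype.sum_prod_type, one_apply,
      mul_ite, mul_one, mul_zero, ite_mul, zero_mul, sum_ite_eq, sum_ite_eq', mem_univ, if_true,
      sum_mul]
    exact sum_congr rfl fun e' _ => sum_congr rfl fun a' _ => by ring
  rw [Matrix.sum_apply, sum_congr rfl fun g _ => h1 g, sum_comm]
  rw [sum_congr rfl fun e' _ => sum_comm]
  simp only [← sum_mul, sum_mul_pauliString]
  by_cases h : a = e
  · subst h
    simp [partialTraceA, ite_mul, mul_sum]
  · simp [h]

theorem trace_one_kronecker_mul (X : Matrix (Bits c) (Bits c) ℂ)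
    (Y : Matrix (Bits n × Bits c) (Bits n × Bits c) ℂ) :
    trace (((1 : Matrix (Bits n) (Bits n) ℂ) ⊗ₖ X) * Y) = trace (X * partialTraceA Y) := by
  simp only [trace, diag_apply, mul_apply, kroneckerMap_apply, Fintype.sum_prod_type, one_apply,
    ite_mul, one_mul, zero_mul, partialTraceA, of_apply, mul_sum]
  rw [sum_comm]
  refine sum_congr rfl fun b _ => ?_
  rw [sum_comm]
  conv_lhs => rw [sum_congr rfl fun b' _ => sum_comm]
  rw [sum_comm]
  simp

theorem partialTraceA_conjTranspose (Y : Matrix (Bits n × Bits c) (Bits n × Bits c) ℂ) :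
    partialTraceA Yᴴ = (partialTraceA Y)ᴴ := by
  ext b b'
  simp [partialTraceA]

theorem trace_partialTraceA (Y : Matrix (Bits n × Bits c) (Bits n × Bits c) ℂ) :
    trace (partialTraceA Y) = trace Y := by
  simp only [trace, diag_apply, partialTraceA, of_apply, Fintype.sum_prod_type]
  rw [sum_comm]

theorem trace_mul_conjTranspose {ι : Type*} [Fintype ι] (X : Matrix ι ι ℂ) :
    trace (X * Xᴴ) = ((∑ i, ∑ j, ‖X i j‖ ^ 2 : ℝ) : ℂ) := by
  simp [trace, mul_apply, Complex.mul_conj, Complex.normSq_eq_norm_sq]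

theorem norm_trace_sq_le {ι : Type*} [Fintype ι] (X : Matrix ι ι ℂ) :
    ‖trace X‖ ^ 2 ≤ Fintype.card ι * ∑ i, ∑ j, ‖X i j‖ ^ 2 := by
  have h1 : ‖trace X‖ ≤ ∑ i, ‖X i i‖ := norm_sum_le _ _
  have h2 : (∑ i, ‖X i i‖) ^ 2 ≤ Fintype.card ι * ∑ i, ‖X i i‖ ^ 2 := by
    simpa using sq_sum_le_card_mul_sum_sq (s := univ) (f := fun i => ‖X i i‖)
  have h3 : ∑ i, ‖X i i‖ ^ 2 ≤ ∑ i, ∑ j, ‖X i j‖ ^ 2 :=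
    sum_le_sum fun i _ => single_le_sum (f := fun j => ‖X i j‖ ^ 2)
      (fun j _ => by positivity) (mem_univ i)
  calc ‖trace X‖ ^ 2 ≤ (∑ i, ‖X i i‖) ^ 2 := by gcongr
    _ ≤ _ := h2
    _ ≤ _ := by gcongr

/-- The matrix of the orthogonal projector onto `Q`. -/
noncomputable def projMatrix (Q : Submodule ℂ (StateSpace n c)) :
    Matrix (Bits n × Bits c) (Bits n × Bits c) ℂ :=
  (Matrix.toEuclideanCLM (𝕜 := ℂ)).symm Q.starProjection

theorem toEuclideanCLM_projMatrix (Q : Submodule ℂ (StateSpace n c)) :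
    Matrix.toEuclideanCLM (𝕜 := ℂ) (projMatrix Q) = Q.starProjection :=
  (Matrix.toEuclideanCLM (𝕜 := ℂ)).apply_symm_apply _

theorem projMatrix_mul_self (Q : Submodule ℂ (StateSpace n c)) :
    projMatrix Q * projMatrix Q = projMatrix Q := by
  rw [projMatrix, ← map_mul, Q.isIdempotentElem_starProjection.eq]

theorem projMatrix_conjTranspose (Q : Submodule ℂ (StateSpace n c)) :
    (projMatrix Q)ᴴ = projMatrix Q := by
  refine EquivLike.injective (Matrix.toEuclideanCLM (𝕜 := ℂ)) ?_
  rw [← star_eq_conjTranspose]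
  refine ((Matrix.toEuclideanCLM (𝕜 := ℂ)).map_star' _).trans ?_
  change star (Matrix.toEuclideanCLM (𝕜 := ℂ) (projMatrix Q)) = _
  rw [toEuclideanCLM_projMatrix, (isSelfAdjoint_starProjection Q).star_eq]

theorem trace_projMatrix (Q : Submodule ℂ (StateSpace n c)) :
    trace (projMatrix Q) = Module.finrank ℂ Q := by
  have h1 : LinearMap.trace ℂ _ (Q.starProjection : StateSpace n c →ₗ[ℂ] StateSpace n c) =
      Module.finrank ℂ Q :=
    LinearMap.IsProj.trace ⟨fun x => Q.starProjection_apply_mem x,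
      fun x hx => Submodule.starProjection_eq_self_iff.2 hx⟩
  have h2 : (Q.starProjection : StateSpace n c →ₗ[ℂ] StateSpace n c) =
      Matrix.toEuclideanLin (projMatrix Q) := by
    rw [← coe_toEuclideanCLM_eq_toEuclideanLin, projMatrix]
    simp
  rw [← h1, h2, Matrix.toEuclideanLin_eq_toLin_orthonormal, Matrix.trace_toLin_eq]

theorem Detectable.projMatrix_mul_mul {Q : Submodule ℂ (StateSpace n c)}
    {E : Matrix (Bits n × Bits c) (Bits n × Bits c) ℂ} (h : Detectable Q E) :
    ∃ lam : ℂ, projMatrix Q * E * projMatrix Q = lam • projMatrix Q := by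
  obtain ⟨lam, h⟩ := h
  refine ⟨lam, EquivLike.injective (Matrix.toEuclideanCLM (𝕜 := ℂ)) ?_⟩
  rw [map_mul, map_mul, map_smul, toEuclideanCLM_projMatrix, mul_assoc]
  exact h

end EAQuantum

/-! ### MacWilliams identity and linear programming bound -/

namespace EAQuantum

open Matrix Finset

variable {n c : ℕ}

/-- The MacWilliams identity. The sign is absorbed by conjugating `E_g` with `E_h`; the sum over `g`
then erases Alice's system from `E_h P`. -/
theorem sum_stringSign_mul_trace (P : Matrix (Bits n × Bits c) (Bits n × Bits c) ℂ)
    (hP : Pᴴ = P) (h : Fin n → Pauli) :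
    ∑ g, ((stringSign g h : ℝ) : ℂ) * trace (aliceString c g * P * aliceString c g * P) =
      2 ^ n * trace (partialTraceA (aliceString c h * P) *
        (partialTraceA (aliceString c h * P))ᴴ) := by
  have h1 : ∀ g, ((stringSign g h : ℝ) : ℂ) * trace (aliceString c g * P * aliceString c g * P) =
      trace (aliceString c h * (aliceString c g * (aliceString c h * P) * aliceString c g) * P) := by
    intro g
    rw [← smul_eq_mul, ← trace_smul, ← smul_mul_assoc, ← smul_mul_assoc, ← smul_mul_assoc,
      ← aliceString_mul_mul]
    simp only [mul_assoc]
  rw [sum_congr rfl fun g _ => h1 g, ← trace_sum, ← sum_mul, ← mul_sum, sum_aliceString_mul_mul,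
    trace_mul_cycle, mul_smul_comm, trace_smul, smul_eq_mul, trace_mul_comm,
    trace_one_kronecker_mul]
  rw [← partialTraceA_conjTranspose, conjTranspose_mul, hP, aliceString_conjTranspose]

/-- Cauchy–Schwarz for the trace on Bob's `2 ^ c`-dimensional space: the source of the factor `2 ^
c` in the bound. -/
theorem norm_trace_aliceString_sq_le (P : Matrix (Bits n × Bits c) (Bits n × Bits c) ℂ)
    (h : Fin n → Pauli) :
    ‖trace (aliceString c h * P)‖ ^ 2 ≤ 2 ^ c * (trace (partialTraceA (aliceString c h * P) *
        (partialTraceA (aliceString c h * P))ᴴ)).re := by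
  rw [trace_mul_conjTranspose, Complex.ofReal_re, ← trace_partialTraceA]
  simpa using norm_trace_sq_le (partialTraceA (aliceString c h * P))

/-- From `P E P = lam P` the two traces are `lam² M` and `lam M`, and the second is real because `E`
and `P` are Hermitian. -/
theorem trace_mul_mul_of_detectable {Q : Submodule ℂ (StateSpace n c)} {g : Fin n → Pauli}
    (hg : Detectable Q (aliceString c g)) :
    (Module.finrank ℂ Q : ℝ) *
        (trace (aliceString c g * projMatrix Q * aliceString c g * projMatrix Q)).re =
      ‖trace (aliceString c g * projMatrix Q)‖ ^ 2 := by
  obtain ⟨lam, hlam⟩ := hg.projMatrix_mul_mul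
  set P := projMatrix Q
  set s := aliceString c g
  have h1 : trace (s * P) = lam * Module.finrank ℂ Q := by
    rw [← trace_projMatrix Q]
    change trace (s * P) = lam • trace P
    rw [← trace_smul, ← hlam, trace_mul_cycle, projMatrix_mul_self, trace_mul_comm]
  have h2 : trace (s * P * s * P) = lam * trace (s * P) := by
    calc trace (s * P * s * P) = trace (s * P * s * (P * P)) := by rw [projMatrix_mul_self]
      _ = trace (s * P * s * P * P) := by rw [mul_assoc (s * P * s)]
      _ = trace (P * (s * P * s * P)) := trace_mul_comm _ _
      _ = trace ((P * s * P) * (s * P)) := by simp only [mul_assoc]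
      _ = trace (lam • (s * (P * P))) := by
        rw [hlam, smul_mul_assoc, trace_smul, trace_smul, trace_mul_comm, mul_assoc]
      _ = _ := by rw [projMatrix_mul_self, trace_smul, smul_eq_mul]
  have h3 : star (trace (s * P)) = trace (s * P) := by
    rw [← trace_conjTranspose, conjTranspose_mul, projMatrix_conjTranspose,
      aliceString_conjTranspose, trace_mul_comm]
  have h4 : ((‖trace (s * P)‖ ^ 2 : ℝ) : ℂ) = Module.finrank ℂ Q * trace (s * P * s * P) := by
    rw [h2, ← Complex.normSq_eq_norm_sq, ← Complex.mul_conj]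
    change _ * star (trace (s * P)) = _
    rw [h3]
    conv_lhs => rw [h1]
    rw [h1]
    ring
  have h5 := congrArg Complex.re h4
  rw [Complex.ofReal_re] at h5
  rw [h5, ← Complex.ofReal_natCast, Complex.re_ofReal_mul]

theorem weight_identity : weight (fun _ : Fin n => Pauli.I) = 0 := by simp [weight]

theorem aliceString_identity : aliceString c (fun _ : Fin n => Pauli.I) = 1 := by
  have : pauliString (fun _ : Fin n => Pauli.I) = 1 := by
    ext a b
    simp only [pauliString, of_apply, Pauli.toMatrix, one_apply]
    rw [prod_ite_zero]
    simp [funext_iff]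
  rw [aliceString, this, one_kronecker_one]

/-- The linear programming bound: a nonnegative function whose character transform vanishes from
weight `d` on bounds the dimension of a code of distance `d`. -/
theorem IsEACode.linear_programming {M d : ℕ} {Q : Submodule ℂ (StateSpace n c)}
    (hQ : IsEACode n M d c Q) (hM : 0 < M) (hd : 0 < d) (φ : (Fin n → Pauli) → ℝ)
    (hφ : ∀ g, 0 ≤ φ g) (hφ0 : 0 < φ fun _ => .I) (lam : ℝ)
    (hvan : ∀ g, d ≤ weight g → ∑ h, φ h * stringSign g h = 0)
    (hle : ∀ g, weight g < d → ∑ h, φ h * stringSign g h ≤ lam * φ g) :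
    (M : ℝ) * 2 ^ n ≤ 2 ^ c * lam := by
  set P := projMatrix Q with hPdef
  set B : (Fin n → Pauli) → ℝ :=
    fun g => (trace (aliceString c g * P * aliceString c g * P)).re with hB
  set C : (Fin n → Pauli) → ℝ := fun h => (trace (partialTraceA (aliceString c h * P) *
        (partialTraceA (aliceString c h * P))ᴴ)).re with hC
  set A : (Fin n → Pauli) → ℝ := fun g => ‖trace (aliceString c g * P)‖ ^ 2 with hA
  have hM' : (0 : ℝ) < M := by exact_mod_cast hM
  have hBC : ∀ h, ∑ g, stringSign g h * B g = 2 ^ n * C h := by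
    intro h
    have := congrArg Complex.re (sum_stringSign_mul_trace P (projMatrix_conjTranspose Q) h)
    have h2 : ((2 : ℂ) ^ n) = ((2 ^ n : ℝ) : ℂ) := by push_cast; rfl
    rw [h2, Complex.re_ofReal_mul, Complex.re_sum] at this
    simpa only [Complex.re_ofReal_mul] using this
  have hAC : ∀ g, A g ≤ 2 ^ c * C g := norm_trace_aliceString_sq_le P
  have hA0 : ∀ g, 0 ≤ A g := fun g => by positivity
  have hAB : ∀ g, weight g < d → M * B g = A g := by
    intro g hg
    have := trace_mul_mul_of_detectable (hQ.detectable g hg)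
    rwa [hQ.finrank_eq] at this
  have hA1 : A (fun _ => .I) = (M : ℝ) ^ 2 := by
    simp only [hA, aliceString_identity, one_mul, hPdef, trace_projMatrix, hQ.finrank_eq]
    simp
  set S := ∑ g with weight g < d, φ g * A g with hS
  -- The identity string has weight `0 < d`, so it contributes `φ(I) M² > 0`; this allows `S` to be
  -- cancelled at the end.
  have hSpos : 0 < S := by
    refine sum_pos' (fun g _ => mul_nonneg (hφ g) (hA0 g)) ⟨fun _ => .I, ?_, ?_⟩
    · simpa [weight_identity] using hd
    · rw [hA1]; positivity
  have key : ∑ h, φ h * (2 ^ n * C h) =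
      ∑ g with weight g < d, (∑ h, φ h * stringSign g h) * B g := by
    rw [sum_filter_of_ne]
    · simp only [← hBC, mul_sum, sum_mul]
      rw [sum_comm]
      exact sum_congr rfl fun g _ => sum_congr rfl fun h _ => by ring
    · intro g _ hne
      by_contra hlt
      exact hne (by rw [hvan g (not_lt.1 hlt), zero_mul])
  have hlow : 2 ^ n * S ≤ 2 ^ c * ∑ h, φ h * (2 ^ n * C h) := by
    rw [hS, mul_sum, mul_sum]
    refine (sum_le_sum_of_subset_of_nonneg (subset_univ _) fun g _ _ => ?_).trans
      (sum_le_sum fun g _ => ?_)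
    · have := mul_nonneg (hφ g) (hA0 g); positivity
    · calc 2 ^ n * (φ g * A g) ≤ 2 ^ n * (φ g * (2 ^ c * C g)) := by
            gcongr
            · exact hφ g
            · exact hAC g
        _ = _ := by ring
  have hup : M * ∑ h, φ h * (2 ^ n * C h) ≤ lam * S := by
    rw [key, hS, mul_sum, mul_sum]
    refine sum_le_sum fun g hg => ?_
    rw [mem_filter] at hg
    calc (M : ℝ) * ((∑ h, φ h * stringSign g h) * B g) =
          (∑ h, φ h * stringSign g h) * (M * B g) := by ring
      _ ≤ (lam * φ g) * (M * B g) := by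
        rw [hAB g hg.2]
        exact mul_le_mul_of_nonneg_right (hle g hg.2) (hA0 g)
      _ = lam * (φ g * A g) := by rw [hAB g hg.2]; ring
  have hfin : (M : ℝ) * 2 ^ n * S ≤ 2 ^ c * lam * S := by
    calc (M : ℝ) * 2 ^ n * S = M * (2 ^ n * S) := by ring
      _ ≤ M * (2 ^ c * ∑ h, φ h * (2 ^ n * C h)) := by gcongr
      _ = 2 ^ c * (M * ∑ h, φ h * (2 ^ n * C h)) := by ring
      _ ≤ 2 ^ c * (lam * S) := by gcongr
      _ = _ := by ring
  exact le_of_mul_le_mul_right hfin hSpos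

end EAQuantum

/-! ### Krawtchouk polynomials and the transform of their squares -/

namespace EAQuantum

open Finset

variable {n : ℕ}

theorem prod_ite_eq_identity {R : Type*} [CommSemiring R] (g : Fin n → Pauli) (u v : R) :
    ∏ j, (if g j = .I then u else v) = u ^ (n - weight g) * v ^ weight g := by
  rw [prod_ite, prod_const, prod_const]
  congr 2
  have := card_filter_add_card_filter_not (s := (univ : Finset (Fin n))) (fun j => g j = .I)
  rw [card_univ, Fintype.card_fin] at this
  simp only [weight, ne_eq]
  omega

theorem weight_le (g : Fin n → Pauli) : weight g ≤ n := by
  simpa [weight] using card_filter_le univ fun j => g j ≠ .I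

theorem pow_weight {R : Type*} [CommSemiring R] (g : Fin n → Pauli) (z : R) :
    z ^ weight g = ∏ j, (if g j = .I then 1 else z) := by
  rw [prod_ite_eq_identity, one_pow, one_mul]

open Polynomial in
/-- The quaternary Krawtchouk polynomial of degree `e` at `w`. -/
noncomputable def krawtchouk (n e w : ℕ) : ℝ :=
  ((1 + 3 * X) ^ (n - w) * (1 - X) ^ w : ℝ[X]).coeff e

/-- The Pauli strings of weight `e`. -/
def sphere (n e : ℕ) : Finset (Fin n → Pauli) := univ.filter fun a => weight a = e

open Polynomial in
theorem sum_sphere_stringSign (g : Fin n → Pauli) (e : ℕ) :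
    ∑ a ∈ sphere n e, stringSign g a = krawtchouk n e (weight g) := by
  have h1 : ∑ a : Fin n → Pauli, C (stringSign g a) * (X : ℝ[X]) ^ weight a =
      (1 + 3 * X) ^ (n - weight g) * (1 - X) ^ weight g := by
    rw [← prod_ite_eq_identity]
    simp only [pow_weight, stringSign, map_prod, ← prod_mul_distrib]
    rw [← Fintype.prod_sum fun j p => C ((g j).sign p) * (if p = .I then 1 else (X : ℝ[X]))]
    refine prod_congr rfl fun j _ => ?_
    rw [Pauli.sum_univ]
    cases g j <;> simp [Pauli.sign] <;> ring
  rw [krawtchouk, ← h1, finsetSum_coeff, sphere, sum_filter]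
  refine sum_congr rfl fun a _ => ?_
  rw [coeff_C_mul, coeff_X_pow]
  simp [eq_comm]

/-- The triple correlation of the commutation signs: it is `4` if `a b g` is a phase,
and `0` otherwise. -/
def Pauli.triple (g a b : Pauli) : ℝ := ∑ p : Pauli, p.sign a * p.sign b * g.sign p

theorem Pauli.triple_nonneg (g a b : Pauli) : 0 ≤ g.triple a b := by
  rw [Pauli.triple, Pauli.sum_univ]
  cases g <;> cases a <;> cases b <;> simp [Pauli.sign] <;> norm_num

theorem Pauli.triple_identity (g : Pauli) (hg : g ≠ .I) : g.triple .I .I = 0 := by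
  rw [Pauli.triple, Pauli.sum_univ]
  cases g <;> simp [Pauli.sign] at hg ⊢

theorem Pauli.sum_triple (g : Pauli) (r : ℝ) :
    ∑ a : Pauli, ∑ b : Pauli, g.triple a b *
      ((if a = .I then 1 else r) * (if b = .I then 1 else r)) =
      if g = .I then 4 * (1 + 3 * r ^ 2) else 4 * (2 * r + 2 * r ^ 2) := by
  simp only [Pauli.triple, Pauli.sum_univ]
  cases g <;> simp [Pauli.sign] <;> ring

/-- `krawtchouk n e` is the transform of the indicator of a sphere, so the transform of its square
is a self-convolution of that indicator. -/
theorem sum_krawtchouk_sq_mul_stringSign (g : Fin n → Pauli) (e : ℕ) :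
    ∑ h, krawtchouk n e (weight h) ^ 2 * stringSign g h =
      ∑ a ∈ sphere n e, ∑ b ∈ sphere n e, ∏ j, (g j).triple (a j) (b j) := by
  have h1 : ∀ a b : Fin n → Pauli, ∏ j, (g j).triple (a j) (b j) =
      ∑ h : Fin n → Pauli, stringSign h a * stringSign h b * stringSign g h := by
    intro a b
    simp only [Pauli.triple, stringSign, ← prod_mul_distrib]
    rw [Fintype.prod_sum]
  simp only [h1, ← sum_sphere_stringSign, sq, sum_mul, mul_sum]
  rw [sum_comm]
  refine sum_congr rfl fun a _ => ?_
  rw [sum_comm]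
  exact sum_congr rfl fun b _ => sum_congr rfl fun h _ => by ring

/-- Two strings of weight `e` cannot cover the support of `g`, and an uncovered position kills the
product. -/
theorem transform_eq_zero (g : Fin n → Pauli) (e : ℕ) (hg : 2 * e < weight g) :
    ∑ h, krawtchouk n e (weight h) ^ 2 * stringSign g h = 0 := by
  rw [sum_krawtchouk_sq_mul_stringSign]
  refine sum_eq_zero fun a ha => sum_eq_zero fun b hb => ?_
  by_contra hne
  rw [← ne_eq, prod_ne_zero_iff] at hne
  have hsub : (univ.filter fun j => g j ≠ .I) ⊆
      (univ.filter fun j => a j ≠ .I) ∪ (univ.filter fun j => b j ≠ .I) := by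
    intro j hj
    simp only [mem_union, mem_filter, mem_univ, true_and] at hj ⊢
    by_contra hab
    push Not at hab
    exact hne j (mem_univ j) (by rw [hab.1, hab.2, Pauli.triple_identity _ hj])
  have hcard := (card_le_card hsub).trans (card_union_le _ _)
  have ha' : weight a = e := (mem_filter.1 ha).2
  have hb' : weight b = e := (mem_filter.1 hb).2
  unfold weight at hg ha' hb'
  omega

/-- Chernoff's trick: all terms being nonnegative, the pairs in the sphere may be enlarged to all
pairs weighted by powers of `r`, and that sum factors over the qubits. -/
theorem transform_le (g : Fin n → Pauli) (e : ℕ) (r : ℝ) (hr : 0 ≤ r) :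
    r ^ (2 * e) * ∑ h, krawtchouk n e (weight h) ^ 2 * stringSign g h ≤
      4 ^ n * ((1 + 3 * r ^ 2) ^ (n - weight g) * (2 * r + 2 * r ^ 2) ^ weight g) := by
  have hnn : ∀ a b : Fin n → Pauli, 0 ≤ ∏ j, (g j).triple (a j) (b j) :=
    fun a b => prod_nonneg fun j _ => Pauli.triple_nonneg _ _ _
  calc r ^ (2 * e) * ∑ h, krawtchouk n e (weight h) ^ 2 * stringSign g h
      = ∑ a ∈ sphere n e, ∑ b ∈ sphere n e,
          (∏ j, (g j).triple (a j) (b j)) * (r ^ weight a * r ^ weight b) := by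
        rw [sum_krawtchouk_sq_mul_stringSign, mul_sum]
        refine sum_congr rfl fun a ha => ?_
        rw [mul_sum]
        refine sum_congr rfl fun b hb => ?_
        rw [(mem_filter.1 ha).2, (mem_filter.1 hb).2]
        ring
    _ ≤ ∑ a, ∑ b, (∏ j, (g j).triple (a j) (b j)) * (r ^ weight a * r ^ weight b) := by
        refine (sum_le_sum fun a _ => sum_le_sum_of_subset_of_nonneg (subset_univ _)
          fun b _ _ => ?_).trans (sum_le_sum_of_subset_of_nonneg (subset_univ _) fun a _ _ =>
            sum_nonneg fun b _ => ?_)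
        all_goals have := hnn a b; positivity
    _ = ∏ j, ∑ p : Pauli, ∑ q : Pauli, (g j).triple p q *
          ((if p = .I then 1 else r) * (if q = .I then 1 else r)) := by
        simp only [pow_weight, ← prod_mul_distrib]
        rw [Fintype.prod_sum]
        refine sum_congr rfl fun a _ => ?_
        rw [Fintype.prod_sum]
    _ = 4 ^ n * ((1 + 3 * r ^ 2) ^ (n - weight g) * (2 * r + 2 * r ^ 2) ^ weight g) := by
        simp only [Pauli.sum_triple]
        rw [prod_ite_eq_identity, mul_pow, mul_pow]
        have : (4 : ℝ) ^ n = 4 ^ (n - weight g) * 4 ^ weight g := by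
          rw [← pow_add, Nat.sub_add_cancel (weight_le g)]
        rw [this]
        ring

open Polynomial in
theorem krawtchouk_zero (n e : ℕ) : krawtchouk n e 0 = n.choose e * 3 ^ e := by
  rw [krawtchouk, pow_zero, mul_one, Nat.sub_zero, add_comm, add_pow, finsetSum_coeff]
  have h3 : ∀ m, (3 * X : ℝ[X]) ^ m * 1 ^ (n - m) * (n.choose m : ℝ[X]) =
      C (3 ^ m * n.choose m : ℝ) * X ^ m := by
    intro m
    simp only [mul_pow, map_mul, map_pow, map_natCast, map_ofNat, one_pow]
    ring
  simp only [h3, coeff_C_mul, coeff_X_pow]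
  simp only [mul_ite, mul_one, mul_zero, sum_ite_eq, mem_range]
  split_ifs with h
  · ring
  · rw [Nat.choose_eq_zero_of_lt (by omega)]
    simp

open Polynomial in
-- Coefficient comparison in a differential identity for the generating function: `X * derivative`
-- multiplies the coefficient of index `e` by `e`.
theorem krawtchouk_recurrence (n e w : ℕ) (hw : w + 1 < n) :
    3 * ((n : ℝ) - (w + 1)) * krawtchouk n e (w + 2) =
      (3 * n - 2 * (w + 1) - 4 * e) * krawtchouk n e (w + 1) - (w + 1) * krawtchouk n e w := by
  obtain ⟨m, rfl⟩ : ∃ m, n = m + (w + 2) := ⟨n - (w + 2), by omega⟩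
  have e0 : m + (w + 2) - w = m + 2 := by omega
  have e1 : m + (w + 2) - (w + 1) = m + 1 := by omega
  have e2 : m + (w + 2) - (w + 2) = m := by omega
  simp only [krawtchouk, e0, e1, e2]
  set G1 : ℝ[X] := (1 + 3 * X) ^ (m + 1) * (1 - X) ^ (w + 1) with hG1
  have hd : derivative G1 = 3 * ((m : ℝ[X]) + 1) * (1 + 3 * X) ^ m * (1 - X) ^ (w + 1) -
      ((w : ℝ[X]) + 1) * (1 + 3 * X) ^ (m + 1) * (1 - X) ^ w := by
    rw [hG1]
    simp [derivative_mul, derivative_pow]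
    ring
  have hpoly : C (3 * ((m : ℝ) + 1)) * ((1 + 3 * X) ^ m * (1 - X) ^ (w + 2)) =
      C (3 * ((m : ℝ) + (w + 2)) - 2 * (w + 1)) * G1 - C 4 * (X * derivative G1) -
        C ((w : ℝ) + 1) * ((1 + 3 * X) ^ (m + 2) * (1 - X) ^ w) := by
    rw [hd, hG1]
    simp only [map_mul, map_add, map_sub, map_natCast, map_ofNat, map_one]
    ring
  have hX : (X * derivative G1).coeff e = e * G1.coeff e := by
    cases e with
    | zero => simp
    | succ k => rw [coeff_X_mul, coeff_derivative]; push_cast; ring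
  have := congrArg (fun p => p.coeff e) hpoly
  simp only [coeff_sub, coeff_C_mul, hX] at this
  push_cast
  linear_combination this

open Polynomial in
theorem krawtchouk_one (n e : ℕ) (hn : 0 < n) :
    3 * (n : ℝ) * krawtchouk n e 1 = (3 * n - 4 * e) * krawtchouk n e 0 := by
  obtain ⟨m, rfl⟩ : ∃ m, n = m + 1 := ⟨n - 1, by omega⟩
  simp only [krawtchouk, Nat.add_sub_cancel, Nat.sub_zero, pow_one, pow_zero, mul_one]
  set G1 : ℝ[X] := (1 + 3 * X) ^ (m + 1) with hG1
  have hd : derivative G1 = 3 * ((m : ℝ[X]) + 1) * (1 + 3 * X) ^ m := by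
    rw [hG1]
    simp [derivative_pow]
    ring
  have hpoly : C (3 * ((m : ℝ) + 1)) * ((1 + 3 * X) ^ m * (1 - X)) =
      C (3 * ((m : ℝ) + 1)) * G1 - C 4 * (X * derivative G1) := by
    rw [hd, hG1]
    simp only [map_mul, map_add, map_natCast, map_ofNat, map_one]
    ring
  have hX : (X * derivative G1).coeff e = e * G1.coeff e := by
    cases e with
    | zero => simp
    | succ k => rw [coeff_X_mul, coeff_derivative]; push_cast; ring
  have := congrArg (fun p => p.coeff e) hpoly
  simp only [coeff_sub, coeff_C_mul, hX] at this
  push_cast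
  linear_combination this

end EAQuantum

/-! ### Lower bounds for Krawtchouk values and binomial coefficients -/

namespace EAQuantum

open Finset

/-- A decreasing sequence of lower bounds for the ratios of consecutive values of the Krawtchouk
polynomial of degree `e`, before twice its degree. -/
noncomputable def ratioBound (e w : ℕ) : ℝ :=
  if 50 * w ≤ 23 * e then 3 / 4 else if 25 * w ≤ 21 * e then 18 / 25
    else if 3 * w ≤ 4 * e then 2 / 3 else 1 / 2

theorem ratioBound_pos (e w : ℕ) : 0 < ratioBound e w := by
  unfold ratioBound
  split_ifs <;> norm_num

theorem ratioBound_succ_le (e w : ℕ) : ratioBound e (w + 1) ≤ ratioBound e w := by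
  unfold ratioBound
  split_ifs <;> first | omega | norm_num

/-- Exactly what the recurrence needs to pass a lower bound `y` on one ratio to the next. The
breakpoints of `ratioBound` come from this inequality at `n = 6 * e`, the first two rounded down. -/
theorem ratioBound_quadratic {n e w : ℕ} (hn : 6 * e ≤ n) (hw : w ≤ 2 * e) :
    3 * ((n : ℝ) - w) * ratioBound e w ^ 2 + w ≤ (3 * n - 2 * w - 4 * e) * ratioBound e w := by
  have hn' : 6 * (e : ℝ) ≤ n := by exact_mod_cast hn
  have hw' : (w : ℝ) ≤ 2 * e := by exact_mod_cast hw
  have hw0 : (0 : ℝ) ≤ w := by positivity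
  unfold ratioBound
  split_ifs with h1 h2 h3
  · have : 50 * (w : ℝ) ≤ 23 * e := by exact_mod_cast h1
    linarith
  · have : 25 * (w : ℝ) ≤ 21 * e := by exact_mod_cast h2
    linarith
  · have : 3 * (w : ℝ) ≤ 4 * e := by exact_mod_cast h3
    linarith
  · linarith

theorem krawtchouk_pos_and_ratio {n e : ℕ} (he : 0 < e) (hn : 6 * e ≤ n) (w : ℕ)
    (hw : w < 2 * e) :
    0 < krawtchouk n e w ∧ ratioBound e w * krawtchouk n e w ≤ krawtchouk n e (w + 1) := by
  induction w with
  | zero =>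
    have h0 : 0 < krawtchouk n e 0 := by
      rw [krawtchouk_zero]
      have := Nat.choose_pos (n := n) (k := e) (by omega)
      positivity
    refine ⟨h0, ?_⟩
    have h1 := krawtchouk_one n e (by omega)
    have h2 := ratioBound_quadratic (w := 0) hn (by omega)
    have hy := ratioBound_pos e 0
    have hn0 : (0 : ℝ) < n := by exact_mod_cast (by omega : 0 < n)
    set y := ratioBound e 0
    have h3 : 3 * (n : ℝ) * y ≤ 3 * n - 4 * e := by
      refine le_of_mul_le_mul_right ?_ hy
      simp only [Nat.cast_zero] at h2
      linarith
    have h4 := mul_le_mul_of_nonneg_right h3 h0.le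
    rw [zero_add]
    refine le_of_mul_le_mul_left ?_ (by positivity : 0 < 3 * (n : ℝ))
    linarith
  | succ w ih =>
    obtain ⟨hK, hr⟩ := ih (by omega)
    have hy0 := ratioBound_pos e w
    have hK1 : 0 < krawtchouk n e (w + 1) := lt_of_lt_of_le (by positivity) hr
    refine ⟨hK1, ?_⟩
    have h1 := krawtchouk_recurrence n e w (by omega)
    have h2 := ratioBound_quadratic (w := w + 1) hn (by omega)
    have hy := ratioBound_pos e (w + 1)
    have hle := ratioBound_succ_le e w
    have hn0 : (0 : ℝ) < (n : ℝ) - (w + 1) := by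
      have : ((w + 1 : ℕ) : ℝ) < n := by exact_mod_cast (by omega : w + 1 < n)
      push_cast at this
      linarith
    push_cast at h2
    set y := ratioBound e (w + 1)
    -- Since `ratioBound` decreases, the previous ratio is also at least the new bound `y`; this
    -- controls the negative term of the recurrence.
    have h3 : y * krawtchouk n e w ≤ krawtchouk n e (w + 1) :=
      (mul_le_mul_of_nonneg_right hle hK.le).trans hr
    have h4 := mul_le_mul_of_nonneg_right h2 hK1.le
    have h5 := mul_le_mul_of_nonneg_left h3 (by positivity : (0 : ℝ) ≤ w + 1)
    have h6 : 3 * ((n : ℝ) - (w + 1)) * y * krawtchouk n e (w + 2) =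
      y * ((3 * n - 2 * (w + 1) - 4 * e) * krawtchouk n e (w + 1)
        - (w + 1) * krawtchouk n e w) := by rw [← h1]; ring
    refine le_of_mul_le_mul_left ?_ (by positivity : 0 < 3 * ((n : ℝ) - (w + 1)) * y)
    rw [show w + 1 + 1 = w + 2 from rfl, h6]
    linarith

theorem krawtchouk_pos {n e : ℕ} (he : 0 < e) (hn : 6 * e ≤ n) {w : ℕ} (hw : w ≤ 2 * e) :
    0 < krawtchouk n e w := by
  rcases hw.lt_or_eq with h | h
  · exact (krawtchouk_pos_and_ratio he hn w h).1
  · obtain ⟨v, rfl⟩ : ∃ v, w = v + 1 := ⟨w - 1, by omega⟩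
    obtain ⟨h1, h2⟩ := krawtchouk_pos_and_ratio he hn v (by omega)
    exact lt_of_lt_of_le (mul_pos (ratioBound_pos _ _) h1) h2

theorem abs_log_one_sub_le {x : ℝ} (h0 : 0 ≤ x) (h1 : x < 1) (m : ℕ) :
    |(∑ i ∈ range m, x ^ (i + 1) / (i + 1)) + Real.log (1 - x)| ≤ x ^ (m + 1) / (1 - x) := by
  have := Real.abs_log_sub_add_sum_range_le (x := x) (by rwa [abs_of_nonneg h0]) m
  rwa [abs_of_nonneg h0] at this

theorem log_three_quarters : -0.2877 ≤ Real.log (3 / 4) := by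
  have := (abs_le.1 (abs_log_one_sub_le (x := 1 / 4) (by norm_num) (by norm_num) 12)).1
  norm_num [sum_range_succ] at this ⊢
  linarith

theorem log_eighteen_div : -0.3286 ≤ Real.log (18 / 25) := by
  have := (abs_le.1 (abs_log_one_sub_le (x := 7 / 25) (by norm_num) (by norm_num) 12)).1
  norm_num [sum_range_succ] at this ⊢
  linarith

theorem log_two_thirds : -0.4055 ≤ Real.log (2 / 3) := by
  have := (abs_le.1 (abs_log_one_sub_le (x := 1 / 3) (by norm_num) (by norm_num) 12)).1
  norm_num [sum_range_succ] at this ⊢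
  linarith

theorem log_half : -0.6932 ≤ Real.log (1 / 2) := by
  rw [one_div, Real.log_inv]
  linarith [Real.log_two_lt_d9]

theorem log_seven_tenths : -0.357 ≤ Real.log 0.7 := by
  have := (abs_le.1 (abs_log_one_sub_le (x := 3 / 10) (by norm_num) (by norm_num) 12)).1
  norm_num [sum_range_succ] at this ⊢
  linarith

theorem log_numeric_one : Real.log 0.54146 ≤ -0.613 := by
  have := (abs_le.1 (abs_log_one_sub_le (x := 0.45854) (by norm_num) (by norm_num) 12)).2
  norm_num [sum_range_succ] at this ⊢
  linarith

theorem log_numeric_two : Real.log 0.3557 ≤ -1.03 := by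
  have := (abs_le.1 (abs_log_one_sub_le (x := 0.6443) (by norm_num) (by norm_num) 24)).2
  norm_num [sum_range_succ] at this ⊢
  linarith

theorem log_numeric_three : Real.log 0.243 ≤ -1.41 := by
  have := (abs_le.1 (abs_log_one_sub_le (x := 0.757) (by norm_num) (by norm_num) 30)).2
  norm_num [sum_range_succ] at this ⊢
  linarith

/-- A piecewise linear lower bound for the logarithm of the Krawtchouk polynomial. -/
theorem log_krawtchouk_ge {n e : ℕ} (he : 0 < e) (hn : 6 * e ≤ n) (w : ℕ) (hw : w ≤ 2 * e) :
    -- The disjunction says that `D` is at least the minimum of four lines. Slopes are rounded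
    -- logarithms of the values of `ratioBound`; intercepts make adjacent lines meet at `0.46 e`,
    -- `0.84 e` and `4 e / 3`.
    let D := Real.log (krawtchouk n e w) - Real.log (krawtchouk n e 0);
    -0.2877 * w ≤ D ∨ -0.3286 * w + 0.0409 * 0.46 * e ≤ D ∨
      -0.4055 * w + (0.0409 * 0.46 + 0.0769 * 0.84) * e ≤ D ∨
      -0.6932 * w + (0.0409 * 0.46 + 0.0769 * 0.84 + 0.2877 * 4 / 3) * e ≤ D := by
  intro D
  induction w with
  | zero => left; simp [D]
  | succ w ih =>
    obtain ⟨hK, hr⟩ := krawtchouk_pos_and_ratio he hn w (by omega)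
    have hlog := Real.log_le_log (mul_pos (ratioBound_pos e w) hK) hr
    rw [Real.log_mul (ratioBound_pos e w).ne' hK.ne'] at hlog
    have ih := ih (by omega)
    simp only at ih
    have hw0 : (0 : ℝ) ≤ w := by positivity
    have hw' : (w : ℝ) + 1 ≤ 2 * e := by exact_mod_cast hw
    simp only [D]
    push_cast
    unfold ratioBound at hlog
    split_ifs at hlog with h1 h2 h3
    · have h1' : 50 * (w : ℝ) ≤ 23 * e := by exact_mod_cast h1
      left
      have := log_three_quarters
      rcases ih with ih | ih | ih | ih <;> linarith
    · have h1' : 23 * (e : ℝ) ≤ 50 * w := by exact_mod_cast (not_le.1 h1).le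
      have h2' : 25 * (w : ℝ) ≤ 21 * e := by exact_mod_cast h2
      right; left
      have := log_eighteen_div
      rcases ih with ih | ih | ih | ih <;> linarith
    · have h2' : 21 * (e : ℝ) ≤ 25 * w := by exact_mod_cast (not_le.1 h2).le
      have h3' : 3 * (w : ℝ) ≤ 4 * e := by exact_mod_cast h3
      right; right; left
      have := log_two_thirds
      rcases ih with ih | ih | ih | ih <;> linarith
    · have h3' : 4 * (e : ℝ) ≤ 3 * w := by exact_mod_cast (not_le.1 h3).le
      right; right; right
      have := log_half
      rcases ih with ih | ih | ih | ih <;> linarith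

/-- The largest term of the binomial expansion with ratio `e / (n - e)` has index `e`. -/
theorem pow_le_mul_choose {n e : ℕ} (he : 0 < e) (hen : e < n) :
    (1 + (e : ℝ) / (n - e)) ^ n ≤ (n + 1) * (n.choose e * ((e : ℝ) / (n - e)) ^ e) := by
  have hne : (0 : ℝ) < n - e := by
    have : (e : ℝ) < n := by exact_mod_cast hen
    linarith
  set x := (e : ℝ) / (n - e) with hx
  have hx0 : 0 < x := by positivity
  have hstep : ∀ j, j ≤ n → (n.choose (j + 1) : ℝ) * (j + 1) = n.choose j * (n - j) := by
    intro j hj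
    have := Nat.choose_succ_right_eq n j
    have h := congrArg (Nat.cast (R := ℝ)) this
    push_cast [Nat.cast_sub hj] at h
    exact h
  have hup : ∀ j, j + 1 ≤ e → (n.choose j : ℝ) * x ^ j ≤ n.choose (j + 1) * x ^ (j + 1) := by
    intro j hj
    have hj' : (j : ℝ) + 1 ≤ e := by exact_mod_cast hj
    refine le_of_mul_le_mul_left ?_ (by positivity : (0 : ℝ) < j + 1)
    calc ((j : ℝ) + 1) * (n.choose j * x ^ j) ≤ ((n - j) * x) * (n.choose j * x ^ j) := by
          gcongr
          rw [hx, mul_div_assoc', le_div_iff₀ hne]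
          nlinarith
      _ = (n.choose j * (n - j)) * x ^ (j + 1) := by ring
      _ = _ := by rw [← hstep j (by omega)]; ring
  have hdown : ∀ j, e ≤ j → j ≤ n →
      (n.choose (j + 1) : ℝ) * x ^ (j + 1) ≤ n.choose j * x ^ j := by
    intro j hj hjn
    have hj' : (e : ℝ) ≤ j := by exact_mod_cast hj
    refine le_of_mul_le_mul_left ?_ (by positivity : (0 : ℝ) < j + 1)
    calc ((j : ℝ) + 1) * (n.choose (j + 1) * x ^ (j + 1)) =
          (n.choose (j + 1) * (j + 1)) * x ^ (j + 1) := by ring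
      _ = ((n - j) * x) * (n.choose j * x ^ j) := by rw [hstep j hjn]; ring
      _ ≤ (j + 1) * (n.choose j * x ^ j) := by
          gcongr
          rw [hx, mul_div_assoc', div_le_iff₀ hne]
          nlinarith
  have hmax : ∀ j, j ≤ n → (n.choose j : ℝ) * x ^ j ≤ n.choose e * x ^ e := by
    intro j hj
    rcases le_total e j with h | h
    · induction j, h using Nat.le_induction with
      | base => exact le_rfl
      | succ k hk ih => exact (hdown k hk (by omega)).trans (ih (by omega))
    · induction h using Nat.decreasingInduction with
      | self => exact le_rfl
      | of_succ k hk ih => exact (hup k hk).trans (ih (by omega))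
  rw [add_comm, add_pow]
  calc ∑ m ∈ range (n + 1), x ^ m * 1 ^ (n - m) * (n.choose m : ℝ)
      ≤ ∑ m ∈ range (n + 1), (n.choose e : ℝ) * x ^ e := by
        refine sum_le_sum fun m hm => ?_
        have := hmax m (by simpa [Nat.lt_succ_iff] using hm)
        rw [one_pow, mul_one, mul_comm]
        exact this
    _ = _ := by simp

end EAQuantum

/-! ### Comparison of the two estimates and the finite Hamming bound -/

namespace EAQuantum

open Finset

variable {n : ℕ}

/-- `transform_le` at `r = s * q` with `3 * q ^ 2 = e / (n - e)`, the optimal `r` at weight `0`; the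
scale `s` adapts it to larger weights. -/
theorem transform_le_of_scale {e : ℕ} (he : 0 < e) (hn : 6 * e ≤ n) (g : Fin n → Pauli)
    {s β : ℝ} (hs : 0 < s) (hs1 : s ≤ 1) (hβ : 0.430334 * s + s ^ 2 / 9 ≤ β) :
    s ^ (2 * e) * ∑ h, krawtchouk n e (weight h) ^ 2 * stringSign g h ≤
      4 ^ n * ((n + 1) * krawtchouk n e 0 *
        (Real.exp (-(1 - s ^ 2) * (e - weight g / 6)) * β ^ weight g)) := by
  have he' : (0 : ℝ) < e := by exact_mod_cast he
  have hn' : 6 * (e : ℝ) ≤ n := by exact_mod_cast hn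
  have hn0 : (0 : ℝ) < n := by linarith
  have hne : (0 : ℝ) < n - e := by linarith
  have hw : weight g ≤ n := weight_le g
  set w := weight g
  set F := ∑ h, krawtchouk n e (weight h) ^ 2 * stringSign g h
  set x := (e : ℝ) / (n - e) with hx
  have hx0 : 0 < x := by positivity
  have hx5 : x ≤ 1 / 5 := by
    rw [hx, div_le_iff₀ hne]
    linarith
  -- `√(x / 3) / (1 + x)` increases up to `x = 1 / 5`, where it is about `0.215166`; twice the
  -- constant is `0.430334`.
  have hsqrt : Real.sqrt (x / 3) ≤ 0.215167 * (1 + x) := by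
    rw [Real.sqrt_le_left (by positivity)]
    nlinarith [mul_nonneg (by linarith : 0 ≤ 1 / 5 - x) (by linarith : 0 ≤ 5 - x)]
  have hsq : Real.sqrt (x / 3) ^ 2 = x / 3 := Real.sq_sqrt (by positivity)
  have hsq0 : 0 ≤ Real.sqrt (x / 3) := Real.sqrt_nonneg _
  set q := Real.sqrt (x / 3)
  have h1 := transform_le g e (s * q) (by positivity)
  -- As `x / (1 + x) = e / n`, the left side equals `(1 + x) * (1 - (1 - s ^ 2) * (e / n))`.
  have hA : 1 + 3 * (s * q) ^ 2 ≤ (1 + x) * Real.exp (-(1 - s ^ 2) * (e / n)) := by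
    have h2 : 1 - (1 - s ^ 2) * (e / n) ≤ Real.exp (-(1 - s ^ 2) * (e / n)) := by
      have := Real.add_one_le_exp (-(1 - s ^ 2) * ((e : ℝ) / n))
      linarith
    refine le_trans (le_of_eq ?_) (mul_le_mul_of_nonneg_left h2 (by positivity))
    rw [mul_pow, hsq, hx]
    field_simp
    ring
  have hB : 2 * (s * q) + 2 * (s * q) ^ 2 ≤ (1 + x) * β := by
    have h2 : (1 + x) * (0.430334 * s + s ^ 2 / 9) ≤ (1 + x) * β := by gcongr
    refine le_trans ?_ h2
    rw [mul_pow, hsq]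
    have h3 := mul_le_mul_of_nonneg_left hsqrt hs.le
    have h4 : s ^ 2 * (6 * x) ≤ s ^ 2 * (1 + x) := by
      gcongr
      linarith
    linarith
  have hβ0 : 0 ≤ β := le_trans (by positivity) hβ
  have hexp : Real.exp (-(1 - s ^ 2) * (e / n)) ^ (n - w) ≤
      Real.exp (-(1 - s ^ 2) * (e - w / 6)) := by
    rw [← Real.exp_nat_mul, Real.exp_le_exp, Nat.cast_sub hw]
    have h2 : (e : ℝ) - w / 6 ≤ (n - w) * (e / n) := by
      have h3 : (e : ℝ) / n ≤ 1 / 6 := by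
        rw [div_le_iff₀ hn0]
        linarith
      have h4 : (w : ℝ) * (e / n) ≤ w * (1 / 6) := by gcongr
      have h5 : (n : ℝ) * (e / n) = e := mul_div_cancel₀ _ hn0.ne'
      linarith
    have h3 : 0 ≤ 1 - s ^ 2 := by nlinarith
    have h4 := mul_le_mul_of_nonneg_left h2 h3
    linarith
  have hch := pow_le_mul_choose he (by omega : e < n)
  rw [← hx] at hch
  have hx3 : (0 : ℝ) < (x / 3) ^ e := by positivity
  refine le_of_mul_le_mul_right ?_ hx3
  clear_value x
  calc s ^ (2 * e) * F * (x / 3) ^ e = (s * q) ^ (2 * e) * F := by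
        rw [mul_pow s q, pow_mul q, hsq]; ring
    _ ≤ 4 ^ n * ((1 + 3 * (s * q) ^ 2) ^ (n - w) * (2 * (s * q) + 2 * (s * q) ^ 2) ^ w) := h1
    _ ≤ 4 ^ n * (((1 + x) * Real.exp (-(1 - s ^ 2) * (e / n))) ^ (n - w) *
          ((1 + x) * β) ^ w) := by gcongr
    _ = 4 ^ n * ((1 + x) ^ n * (Real.exp (-(1 - s ^ 2) * (e / n)) ^ (n - w) * β ^ w)) := by
        have : (1 + x) ^ n = (1 + x) ^ (n - w) * (1 + x) ^ w := by
          rw [← pow_add, Nat.sub_add_cancel hw]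
        rw [this, mul_pow, mul_pow]
        ring
    _ ≤ 4 ^ n * (((n + 1) * (n.choose e * x ^ e)) *
          (Real.exp (-(1 - s ^ 2) * (e - w / 6)) * β ^ w)) := by gcongr
    _ = _ := by
        have : x ^ e = (x / 3) ^ e * 3 ^ e := by rw [← mul_pow, div_mul_cancel₀ _ three_ne_zero]
        rw [krawtchouk_zero, this]
        ring

theorem transform_le_of_log_le {e : ℕ} (he : 0 < e) (hn : 6 * e ≤ n) (g : Fin n → Pauli)
    (hg : weight g ≤ 2 * e) {s β : ℝ} (hs : 0 < s) (hs1 : s ≤ 1)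
    (hβ : 0.430334 * s + s ^ 2 / 9 ≤ β)
    (hlog : -(1 - s ^ 2) * (e - weight g / 6) + weight g * Real.log β ≤ 2 * (e * Real.log s) +
      2 * (Real.log (krawtchouk n e (weight g)) - Real.log (krawtchouk n e 0))) :
    ∑ h, krawtchouk n e (weight h) ^ 2 * stringSign g h ≤
      4 ^ n * (n + 1) / krawtchouk n e 0 * krawtchouk n e (weight g) ^ 2 := by
  have h1 := transform_le_of_scale he hn g hs hs1 hβ
  have hK0 := krawtchouk_pos he hn (w := 0) (by omega)
  have hK := krawtchouk_pos he hn hg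
  have hβ0 : 0 < β := lt_of_lt_of_le (by positivity) hβ
  set w := weight g
  set K0 := krawtchouk n e 0
  set K := krawtchouk n e w
  set F := ∑ h, krawtchouk n e (weight h) ^ 2 * stringSign g h
  set Y := Real.exp (-(1 - s ^ 2) * (e - w / 6)) with hY
  have hY0 : 0 < Y := Real.exp_pos _
  have h2 : K0 ^ 2 * (Y * β ^ w) ≤ s ^ (2 * e) * K ^ 2 := by
    rw [← Real.log_le_log_iff (by positivity) (by positivity),
      Real.log_mul (by positivity) (by positivity), Real.log_mul (by positivity) (by positivity),
      Real.log_mul (by positivity) (by positivity), hY, Real.log_exp, Real.log_pow, Real.log_pow,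
      Real.log_pow, Real.log_pow]
    push_cast
    linarith
  have hs2 : 0 < s ^ (2 * e) := by positivity
  refine le_of_mul_le_mul_left (h1.trans ?_) hs2
  calc 4 ^ n * ((n + 1) * K0 * (Y * β ^ w)) = 4 ^ n * (n + 1) / K0 * (K0 ^ 2 * (Y * β ^ w)) := by
        field_simp
    _ ≤ 4 ^ n * (n + 1) / K0 * (s ^ (2 * e) * K ^ 2) := by gcongr
    _ = _ := by ring

theorem transform_le_krawtchouk_sq {e : ℕ} (he : 0 < e) (hn : 6 * e ≤ n) (g : Fin n → Pauli)
    (hg : weight g ≤ 2 * e) :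
    ∑ h, krawtchouk n e (weight h) ^ 2 * stringSign g h ≤
      4 ^ n * (n + 1) / krawtchouk n e 0 * krawtchouk n e (weight g) ^ 2 := by
  have hD := log_krawtchouk_ge he hn (weight g) hg
  simp only at hD
  have hw0 : (0 : ℝ) ≤ weight g := by positivity
  have he0 : (0 : ℝ) ≤ e := by positivity
  have hg' : (weight g : ℝ) ≤ 2 * e := by exact_mod_cast hg
  -- The ranges end at breakpoints of `ratioBound`. They use `s = 1`, `0.7`, `1 / 2`, and `β` is
  -- `0.430334 * s + s ^ 2 / 9` rounded up.
  by_cases c1 : (weight g : ℝ) ≤ 0.84 * e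
  · refine transform_le_of_log_le he hn g hg one_pos le_rfl (β := 0.54146) (by norm_num) ?_
    have h1 := mul_le_mul_of_nonneg_left log_numeric_one hw0
    rw [Real.log_one]
    rcases hD with h | h | h | h <;> linarith
  by_cases c2 : (weight g : ℝ) ≤ 4 / 3 * e
  · refine transform_le_of_log_le he hn g hg (s := 0.7) (by norm_num) (by norm_num)
      (β := 0.3557) (by norm_num) ?_
    have h1 := mul_le_mul_of_nonneg_left log_numeric_two hw0
    have h2 := mul_le_mul_of_nonneg_left log_seven_tenths he0
    rcases hD with h | h | h | h <;> linarith
  · refine transform_le_of_log_le he hn g hg (s := 1 / 2) (by norm_num) (by norm_num)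
      (β := 0.243) (by norm_num) ?_
    have h1 := mul_le_mul_of_nonneg_left log_numeric_three hw0
    have h2 := mul_le_mul_of_nonneg_left log_half he0
    rcases hD with h | h | h | h <;> linarith

/-- A nonasymptotic Hamming bound for entanglement-assisted codes. -/
theorem IsEACode.hamming {M d c : ℕ} {Q : Submodule ℂ (StateSpace n c)}
    (hQ : IsEACode n M d c Q) (hM : 0 < M) (hd : 3 * d < n) :
    (M : ℝ) * (n.choose ((d - 1) / 2) * 3 ^ ((d - 1) / 2)) ≤ 2 ^ c * 2 ^ n * (n + 1) := by
  set e := (d - 1) / 2 with hedef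
  rcases Nat.eq_zero_or_pos e with he | he
  · rw [he]
    have h1 : M ≤ 2 ^ n * 2 ^ c := by
      have := Submodule.finrank_le Q
      rw [hQ.finrank_eq] at this
      simpa using this
    have h2 : (M : ℝ) ≤ 2 ^ n * 2 ^ c := by exact_mod_cast h1
    have h3 : (0 : ℝ) ≤ 2 ^ c * 2 ^ n * n := by positivity
    simp only [Nat.choose_zero_right, Nat.cast_one, pow_zero, mul_one]
    linarith
  · have hn : 6 * e ≤ n := by omega
    have hK := krawtchouk_pos he hn (w := 0) (by omega)
    have h := hQ.linear_programming hM (by omega) (fun h => krawtchouk n e (weight h) ^ 2)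
      (fun _ => sq_nonneg _) (by simp only [weight_identity]; positivity)
      (4 ^ n * (n + 1) / krawtchouk n e 0)
      (fun g hg => transform_eq_zero g e (by omega))
      (fun g hg => by
        rcases le_or_gt (weight g) (2 * e) with h | h
        · exact transform_le_krawtchouk_sq he hn g h
        · rw [transform_eq_zero g e h]
          positivity)
    rw [← krawtchouk_zero]
    have h4 : (4 : ℝ) ^ n = 2 ^ n * 2 ^ n := by rw [← mul_pow]; norm_num
    rw [mul_div_assoc', le_div_iff₀ hK, h4] at h
    refine le_of_mul_le_mul_right ?_ (by positivity : (0 : ℝ) < 2 ^ n)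
    linarith

end EAQuantum

/-! ### Entropy estimates and the asymptotic bound -/

namespace EAQuantum

theorem binaryEntropy_eq (x : ℝ) : binaryEntropy x = Real.binEntropy x / Real.log 2 := by
  simp only [binaryEntropy, Real.binEntropy, Real.logb, Real.log_inv]
  ring

/-- A concave function vanishing at `0` is subadditive: `a` and `b` are convex combinations of `a +
b` and `0`. -/
theorem binEntropy_add_le {a b : ℝ} (ha : 0 ≤ a) (hb : 0 ≤ b) (hab : a + b ≤ 1) :
    Real.binEntropy (a + b) ≤ Real.binEntropy a + Real.binEntropy b := by
  rcases ha.eq_or_lt with rfl | ha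
  · simp
  have hs : 0 < a + b := by linarith
  have key : ∀ t, 0 ≤ t → t ≤ a + b →
      t / (a + b) * Real.binEntropy (a + b) ≤ Real.binEntropy t := by
    intro t ht hts
    have h0 : 0 ≤ t / (a + b) := by positivity
    have h1 : 0 ≤ 1 - t / (a + b) := by
      rw [sub_nonneg, div_le_one hs]
      exact hts
    have h := Real.strictConcave_binEntropy.concaveOn.2 (⟨hs.le, hab⟩ : a + b ∈ Set.Icc (0 : ℝ) 1)
      (⟨le_rfl, zero_le_one⟩ : (0 : ℝ) ∈ Set.Icc (0 : ℝ) 1) h0 h1 (by ring)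
    simpa [hs.ne'] using h
  have h1 := key a ha.le (by linarith)
  have h2 := key b hb (by linarith)
  have h3 : a / (a + b) * Real.binEntropy (a + b) + b / (a + b) * Real.binEntropy (a + b) =
      Real.binEntropy (a + b) := by
    rw [← add_mul, ← add_div, div_self hs.ne', one_mul]
  linarith

theorem binEntropy_le_log_choose {n e : ℕ} (hen : e < n) :
    n * Real.binEntropy ((e : ℝ) / n) ≤ Real.log (n + 1) + Real.log (n.choose e) := by
  have hn0 : (0 : ℝ) < n := by exact_mod_cast (by omega : 0 < n)
  rcases Nat.eq_zero_or_pos e with rfl | he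
  · simpa using Real.log_nonneg (by linarith : (1 : ℝ) ≤ n + 1)
  have he0 : (0 : ℝ) < e := by exact_mod_cast he
  have hne : (0 : ℝ) < n - e := by
    have : (e : ℝ) < n := by exact_mod_cast hen
    linarith
  have hC : (0 : ℝ) < n.choose e := by exact_mod_cast Nat.choose_pos hen.le
  have h1 : 1 + (e : ℝ) / (n - e) = n / (n - e) := by
    field_simp
    ring
  have h := pow_le_mul_choose he hen
  rw [h1] at h
  have hlog := Real.log_le_log (by positivity) h
  rw [Real.log_mul (by positivity) (by positivity), Real.log_mul (by positivity) (by positivity),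
    Real.log_pow, Real.log_pow, Real.log_div hn0.ne' hne.ne', Real.log_div he0.ne' hne.ne'] at hlog
  have h2 : n * Real.binEntropy ((e : ℝ) / n) =
      n * (Real.log n - Real.log (n - e)) - e * (Real.log e - Real.log (n - e)) := by
    have h3 : 1 - (e : ℝ) / n = (n - e) / n := by field_simp
    rw [Real.binEntropy, h3, Real.log_inv, Real.log_inv, Real.log_div he0.ne' hn0.ne',
      Real.log_div hne.ne' hn0.ne']
    field_simp
    ring
  linarith

/-- The error term of the Hamming bound. -/
noncomputable def hammingError (n : ℕ) : ℝ :=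
  -- One `n + 1` comes from the Hamming bound and one from the binomial coefficient; the other terms
  -- pay for replacing `e` by `d / 2`.
  2 * (Real.logb 2 (n + 1) / n) + Real.logb 2 3 / n + binaryEntropy (1 / n)

theorem tendsto_hammingError : Tendsto hammingError atTop (𝓝 0) := by
  have hn : Tendsto (fun n : ℕ => (n : ℝ)) atTop atTop := tendsto_natCast_atTop_atTop
  have h1 : Tendsto (fun n : ℕ => Real.logb 2 ((n : ℝ) + 1) / n) atTop (𝓝 0) := by
    have h := (Real.isLittleO_log_id_atTop.tendsto_div_nhds_zero).comp
      (tendsto_natCast_atTop_atTop.comp (tendsto_add_atTop_nat 1) :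
        Tendsto (fun n : ℕ => ((n + 1 : ℕ) : ℝ)) atTop atTop)
    have h2 : Tendsto (fun n : ℕ => 1 + (1 : ℝ) / n) atTop (𝓝 (1 + 0)) :=
      tendsto_const_nhds.add (tendsto_const_nhds.div_atTop hn)
    have h3 := (h.mul h2).div_const (Real.log 2)
    rw [zero_mul, zero_div] at h3
    refine h3.congr' ?_
    filter_upwards [eventually_gt_atTop 0] with n hn
    have hn0 : (0 : ℝ) < n := by exact_mod_cast hn
    simp only [Function.comp_apply, id, Real.logb]
    push_cast
    field_simp
  have h2 : Tendsto (fun n : ℕ => Real.logb 2 3 / n) atTop (𝓝 0) :=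
    tendsto_const_nhds.div_atTop hn
  have h3 : Tendsto (fun n : ℕ => binaryEntropy (1 / n)) atTop (𝓝 0) := by
    have h4 : Continuous binaryEntropy := by
      have : binaryEntropy = fun x => Real.binEntropy x / Real.log 2 := funext binaryEntropy_eq
      rw [this]
      exact Real.binEntropy_continuous.div_const _
    have h5 := (h4.tendsto 0).comp ((tendsto_const_nhds (x := (1 : ℝ))).div_atTop hn)
    rwa [binaryEntropy_eq, Real.binEntropy_zero, zero_div] at h5
  have := ((h1.const_mul 2).add h2).add h3
  simp only [mul_zero, add_zero] at this
  exact this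

theorem binaryEntropy_half_le {n d : ℕ} (hn : 0 < n) (hd : 3 * d < n) :
    binaryEntropy ((d : ℝ) / n / 2) ≤
      binaryEntropy ((((d - 1) / 2 : ℕ) : ℝ) / n) + binaryEntropy (1 / n) := by
  have hn0 : (0 : ℝ) < n := by exact_mod_cast hn
  have hlog : 0 < Real.log 2 := Real.log_pos one_lt_two
  simp only [binaryEntropy_eq, ← add_div]
  refine div_le_div_of_nonneg_right ?_ hlog.le
  rcases Nat.eq_zero_or_pos d with rfl | hd0
  · simpa using Real.binEntropy_nonneg (p := (n : ℝ)⁻¹) (by positivity)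
      (inv_le_one_of_one_le₀ (by exact_mod_cast hn))
  set e := (d - 1) / 2 with he
  have h1 : (2 * e + 1 : ℝ) ≤ d := by exact_mod_cast (by omega : 2 * e + 1 ≤ d)
  have h2 : (d : ℝ) ≤ 2 * e + 2 := by exact_mod_cast (by omega : d ≤ 2 * e + 2)
  have h3 : (4 : ℝ) ≤ n := by exact_mod_cast (by omega : 4 ≤ n)
  have h4 : (3 : ℝ) * d < n := by exact_mod_cast hd
  -- The rounding defect `s` lies in `[0, 1 / n]`, and entropy is increasing there because `1 / n ≤
  -- 1 / 2`.
  obtain ⟨s, hs⟩ : ∃ s, s = (d : ℝ) / n / 2 - e / n := ⟨_, rfl⟩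
  have hs' : s = (d / 2 - e) / n := by rw [hs]; ring
  have hs0 : 0 ≤ s := by rw [hs']; exact div_nonneg (by linarith) hn0.le
  have hs1 : s ≤ 1 / n := by rw [hs']; exact div_le_div_of_nonneg_right (by linarith) hn0.le
  have hn4 : (1 : ℝ) / n ≤ 2⁻¹ := by
    rw [div_le_iff₀ hn0]
    linarith
  have hsum : (d : ℝ) / n / 2 = e / n + s := by rw [hs]; ring
  have hle : (d : ℝ) / n / 2 ≤ 1 := by
    rw [div_div, div_le_one (by positivity)]
    linarith
  rw [hsum] at hle ⊢
  have h5 := binEntropy_add_le (by positivity) hs0 hle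
  have h6 : Real.binEntropy s ≤ Real.binEntropy (1 / n) :=
    Real.binEntropy_strictMonoOn.monotoneOn ⟨hs0, hs1.trans hn4⟩ ⟨by positivity, hn4⟩ hs1
  linarith

theorem IsEACode.logb_div_le {n M d c : ℕ} {Q : Submodule ℂ (StateSpace n c)} (hn : 0 < n)
    (hM : 0 < M) (hQ : IsEACode n M d c Q) (hd : 3 * d < n) :
    Real.logb 2 M / n ≤ 1 + (c : ℝ) / n - ((d : ℝ) / n) / 2 * Real.logb 2 3
      - binaryEntropy (((d : ℝ) / n) / 2) + hammingError n := by
  have hn0 : (0 : ℝ) < n := by exact_mod_cast hn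
  have hM0 : (0 : ℝ) < M := by exact_mod_cast hM
  have hlog : 0 < Real.log 2 := Real.log_pos one_lt_two
  have hH := binaryEntropy_half_le hn hd
  have hham := hQ.hamming hM hd
  set e := (d - 1) / 2 with he
  have hen : e < n := by omega
  have hent := binEntropy_le_log_choose hen
  have hC : (0 : ℝ) < n.choose e := by exact_mod_cast Nat.choose_pos hen.le
  have h1 := Real.log_le_log (by positivity) hham
  rw [Real.log_mul (by positivity) (by positivity), Real.log_mul (by positivity) (by positivity),
    Real.log_mul (by positivity) (by positivity), Real.log_mul (by positivity) (by positivity),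
    Real.log_pow, Real.log_pow, Real.log_pow] at h1
  have h3 : 0 < Real.log 3 := Real.log_pos (by norm_num)
  have h2 : (d : ℝ) / 2 ≤ e + 1 := by
    have : (d : ℝ) ≤ 2 * e + 2 := by exact_mod_cast (by omega : d ≤ 2 * e + 2)
    linarith
  have h4 := mul_le_mul_of_nonneg_right h2 h3.le
  have h5 : Real.log M ≤ (c + n) * Real.log 2 - d / 2 * Real.log 3
      - n * Real.binEntropy ((e : ℝ) / n) + 2 * Real.log (n + 1) + Real.log 3 := by linarith
  have h6 : Real.logb 2 M / n ≤ ((c + n) * Real.log 2 - d / 2 * Real.log 3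
      - n * Real.binEntropy ((e : ℝ) / n) + 2 * Real.log (n + 1) + Real.log 3) /
        Real.log 2 / n := by
    rw [Real.logb]
    gcongr
  have h7 : ((c + n) * Real.log 2 - d / 2 * Real.log 3
      - n * Real.binEntropy ((e : ℝ) / n) + 2 * Real.log (n + 1) + Real.log 3) /
        Real.log 2 / n = 1 + (c : ℝ) / n - ((d : ℝ) / n) / 2 * Real.logb 2 3
        - binaryEntropy ((e : ℝ) / n) + 2 * (Real.logb 2 (n + 1) / n) + Real.logb 2 3 / n := by
    rw [binaryEntropy_eq, Real.logb, Real.logb]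
    field_simp
    ring
  rw [hammingError]
  linarith

end EAQuantum

/-- The error term `ε n`, the `o(1)` of the bound, depends on the length `n` only. -/
theorem mainTheorem12 :
    ∃ ε : ℕ → ℝ, Tendsto ε atTop (𝓝 0) ∧
      ∀ (n M d c : ℕ) (Q : Submodule ℂ (EAQuantum.StateSpace n c)),
        0 < n → 0 < M → EAQuantum.IsEACode n M d c Q → (d : ℝ) / n < 1 / 3 →
          Real.logb 2 M / n ≤
            1 + (c : ℝ) / n - ((d : ℝ) / n) / 2 * Real.logb 2 3
              - EAQuantum.binaryEntropy (((d : ℝ) / n) / 2) + ε n := by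
  refine ⟨EAQuantum.hammingError, EAQuantum.tendsto_hammingError,
    fun n M d c Q hn hM hQ hd => hQ.logb_div_le hn hM ?_⟩
  rw [div_lt_div_iff₀ (by exact_mod_cast hn) three_pos, one_mul, mul_comm] at hd
  exact_mod_cast hd
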